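/- Let $\epsilon=t\,\frac{d}{dt}$ be the Euler derivation. A \emph{Fuchsian operator} of order $n\ge 0$ is a differential operator $L=\sum_{i=0}^n a_i(t)\,\epsilon^i$ whose coefficients $a_i$ are germs of holomorphic functions at $0\in\mathbb C$ and whose leading coefficient satisfies $a_n(0)\ne 0$. Expanding the coefficients in powers of $t$ one writes $L=\sum_{k\ge 0}t^kp_k(\epsilon)$ with $p_k\in\mathbb C[\epsilon]$; the polynomial $p_0$, of degree $n$, is called the Euler part of $L$. Two Fuchsian operators $L,M$ of the same order are called \emph{$\mathscr F$-equivalent} if there exist Fuchsian operators $H,K$ (of any orders) such that $MH=KL$ and the Euler parts of $H$ and $L$ are relatively prime in $\mathbb C[\epsilon]$. Let $p_0\in\mathbb C[\epsilon]$ be a nonzero polynomial of degree $n$, and for $j\ge 1$ put $p_0^{[j]}(\epsilon)=p_0(\epsilon+j)$. Let $\mathfrak P=\mathbb C[\epsilon]/\langle p_0\rangle$, identified with the space of polynomials of degree $\le n-1$, and let $\boldsymbol P_j:\mathfrak P\to\mathfrak P$ be the multiplication by $p_0^{[j]}$. Let $\{V_j\}_{j\ge1}$ be an affine normal form for $p_0$,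 that is, a family of linear subspaces $V_j\subseteq\mathfrak P$ such that $\boldsymbol P_j\mathfrak P+V_j=\mathfrak P$ for all $j\ge 1$ (the sum need not be direct). Let $N$ be the largest natural number that is a difference of two roots of $p_0$ ($N=0$ if $p_0$ has no two roots differing by a positive integer). Then every Fuchsian operator $L=p_0(\epsilon)+tp_1(\epsilon)+t^2p_2(\epsilon)+\cdots$ with the Euler part $p_0$ is $\mathscr F$-equivalent to an operator of the form $M=p_0(\epsilon)+\sum_{j=1}^{N}t^jq_j(\epsilon)$, where each $q_j$ is a polynomial of degree $\le n-1$ whose residue class modulo $p_0$ belongs to $V_j$. -/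

import Mathlib

open Polynomial

noncomputable section

namespace Fuchs

/-- A differential operator `∑ aᵢ(t) εⁱ` in its standard form, with (formal) Taylor series
`aᵢ ∈ ℂ⟦t⟧` as coefficients written to the left of the powers of the Euler derivation `ε = t d/dt`.
The polynomial variable stands for `ε`. The additive structure is that of polynomials, the
composition of operators is `opMul` below (and not the commutative product of polynomials). -/
abbrev Operator : Type := Polynomial (PowerSeries ℂ)

/-- The Euler derivation `a ↦ t a'` of the coefficient ring `ℂ⟦t⟧`. -/
def eulerDer : Derivation ℂ (PowerSeries ℂ) (PowerSeries ℂ) :=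
  (PowerSeries.X : PowerSeries ℂ) • PowerSeries.derivative ℂ

/-- The composition `ε ∘ Q`: by the Leibniz rule `ε a = a ε + ε(a)`,
`ε ∘ ∑ bᵢ εⁱ = ∑ bᵢ εⁱ⁺¹ + ∑ ε(bᵢ) εⁱ`. -/
def epsMul (Q : Operator) : Operator :=
  Q * X + Q.sum fun i b => monomial i (eulerDer b)

/-- Composition of differential operators: `(∑ aᵢ εⁱ) ∘ Q = ∑ aᵢ (ε ∘ (ε ∘ ⋯ (ε ∘ Q)))`. -/
def opMul (P Q : Operator) : Operator :=
  P.sum fun i a => a • epsMul^[i] Q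

/-- The series `a ∈ ℂ⟦t⟧` has a positive radius of convergence, that is, it is the Taylor series
of a holomorphic germ at the origin. -/
def IsConvergent (a : PowerSeries ℂ) : Prop :=
  ∃ r : ℝ, 0 < r ∧ Summable fun k : ℕ => ‖PowerSeries.coeff k a‖ * r ^ k

/-- Fuchsian operators: all coefficients are holomorphic germs and the leading coefficient does
not vanish at the origin. (The order of the operator is its degree in `ε`.) -/
def IsFuchsian (L : Operator) : Prop :=
  (∀ i, IsConvergent (L.coeff i)) ∧ PowerSeries.constantCoeff L.leadingCoeff ≠ 0

/-- The Euler part `p₀` of `L = ∑ₖ tᵏ pₖ(ε)`, obtained by putting `t = 0` in all coefficients. -/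
def eulerPart (L : Operator) : ℂ[X] :=
  L.map PowerSeries.constantCoeff

/-- The Euler operator `p(ε)` with constant coefficients. -/
def eulerOp (p : ℂ[X]) : Operator :=
  p.map PowerSeries.C

/-- `L` is `F`-equivalent to `M`: they have the same order and `M H = K L` for some Fuchsian
operators `H`, `K` such that the Euler parts of `H` and `L` are mutually prime. -/
def FuchsianEquivalent (L M : Operator) : Prop :=
  L.natDegree = M.natDegree ∧
    ∃ H K : Operator, IsFuchsian H ∧ IsFuchsian K ∧
      opMul M H = opMul K L ∧ IsCoprime (eulerPart H) (eulerPart L)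

/-- The shift `w(ε) ↦ w(ε + j)`. -/
def shift (w : ℂ[X]) (j : ℕ) : ℂ[X] :=
  w.comp (X + C (j : ℂ))

/-- The quotient algebra `ℂ[ε] / ⟨p₀⟩`. -/
abbrev Residues (p₀ : ℂ[X]) : Type := ℂ[X] ⧸ Ideal.span {p₀}

/-- Multiplication by `p₀(ε + j)` as a linear self-map of `ℂ[ε] / ⟨p₀⟩`. -/
def shiftMul (p₀ : ℂ[X]) (j : ℕ) : Residues p₀ →ₗ[ℂ] Residues p₀ :=
  LinearMap.mulLeft ℂ (Ideal.Quotient.mk (Ideal.span {p₀}) (shift p₀ j))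

/-- An affine normal form for `p₀`: subspaces `V₁, V₂, …` of `ℂ[ε] / ⟨p₀⟩` such that `Vⱼ` and the
image of the multiplication by `p₀(ε + j)` together span the whole space. The sum need not be
direct (it is for minimal normal forms). The value `V 0` is irrelevant. -/
def IsAffineNormalForm (p₀ : ℂ[X]) (V : ℕ → Submodule ℂ (Residues p₀)) : Prop :=
  ∀ j, 1 ≤ j → LinearMap.range (shiftMul p₀ j) ⊔ V j = ⊤

/-- The maximal natural number that is a difference of two roots of `p₀` (for `p₀ ≠ 0`); it is `0`
if there are no roots. -/
def maxResonance (p₀ : ℂ[X]) : ℕ :=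
  sSup {j : ℕ | ∃ z : ℂ, p₀.IsRoot z ∧ p₀.IsRoot (z + j)}

end Fuchs

end

noncomputable section

namespace Fuchs

/-! Since `ε tʲ = tʲ (ε + j)`, the equation `M H = K L` splits by powers of `t`. With Euler parts
`h₀ = k₀ = p₀ε + 1`, which is `1` modulo `p₀`, the component of degree `m ≥ 1` reads `p₀(ε+m) h_m +
q_m ≡ g_m` modulo `p₀`, where `g_m` involves only earlier components. The normal form condition
gives `h_m` and `q_m`, and `k_m` is the quotient by `p₀` (`exists_conjugation_seq`). For `m > N` the
polynomials `p₀` and `p₀(ε+m)` are coprime, so `q_m = 0` is possible and `M` is polynomial in `t`.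

Convergence of `H` and `K` holds because multiplication by `p₀(ε+m)` on residues is asymptotically
`c mⁿ`, so its inverse gains the factor `m⁻ⁿ` (`exists_coeffNorm_remainder_le`). This gain pays for
the shifts in `q_{m-i}(ε+i)`, and a convolution inequality then yields geometric growth
(`geometricallyBounded_of_conjugation`). -/

/-! ### Homogeneous components and composition. -/

/-- The component `pₖ(ε)` of `L = ∑ₖ tᵏ pₖ(ε)`. -/
def part (k : ℕ) : Operator →+ ℂ[X] where
  toFun L := ∑ i ∈ L.support, monomial i (PowerSeries.coeff k (L.coeff i))
  map_zero' := by simp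
  map_add' L M := by
    have := Polynomial.sum_add_index L M
      (fun i a => (monomial i (PowerSeries.coeff k a) : ℂ[X])) (by simp) (by simp)
    simpa [Polynomial.sum] using this

theorem coeff_part (k : ℕ) (L : Operator) (i : ℕ) :
    (part k L).coeff i = PowerSeries.coeff k (L.coeff i) := by
  simp only [part, AddMonoidHom.coe_mk, ZeroHom.coe_mk, finsetSum_coeff, coeff_monomial]
  rw [Finset.sum_ite_eq']
  split_ifs with h
  · rfl
  · simp [notMem_support_iff.mp h]

theorem part_ext {L M : Operator} (h : ∀ k, part k L = part k M) : L = M := by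
  ext i k
  rw [← coeff_part, h, coeff_part]

theorem part_zero_eq_eulerPart (L : Operator) : part 0 L = eulerPart L := by
  ext i
  simp [coeff_part, eulerPart]

theorem part_smul (m : ℕ) (a : PowerSeries ℂ) (Q : Operator) :
    part m (a • Q) = ∑ x ∈ Finset.HasAntidiagonal.antidiagonal m, C (PowerSeries.coeff x.1 a) * part x.2 Q := by
  ext i
  simp [coeff_part, PowerSeries.coeff_mul]

theorem coeff_eulerDer (j : ℕ) (b : PowerSeries ℂ) :
    PowerSeries.coeff j (eulerDer b) = j * PowerSeries.coeff j b := by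
  cases j with
  | zero => simp [eulerDer]
  | succ j =>
    simp [eulerDer, PowerSeries.coeff_succ_X_mul, PowerSeries.coeff_derivative, mul_comm]

theorem part_epsMul (j : ℕ) (Q : Operator) :
    part j (epsMul Q) = (X + C (j : ℂ)) * part j Q := by
  have h : ∀ i, (Q.sum fun i b => monomial i (eulerDer b)).coeff i = eulerDer (Q.coeff i) := by
    intro i
    simp only [Polynomial.sum, finsetSum_coeff, coeff_monomial]
    rw [Finset.sum_ite_eq']
    split_ifs with h
    · rfl
    · simp [notMem_support_iff.mp h]
  ext i
  rw [coeff_part, epsMul, coeff_add, h, map_add, coeff_eulerDer, add_mul, coeff_add, coeff_C_mul,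
    coeff_part]
  congr 1
  cases i with
  | zero => simp
  | succ i => rw [coeff_mul_X, coeff_X_mul, coeff_part]

theorem part_epsMul_iterate (i j : ℕ) (Q : Operator) :
    part j (epsMul^[i] Q) = (X + C (j : ℂ)) ^ i * part j Q := by
  induction i with
  | zero => simp
  | succ i ih => rw [Function.iterate_succ_apply', part_epsMul, ih, pow_succ']; ring

theorem shift_eq_sum {p : ℂ[X]} {D : ℕ} (h : p.natDegree ≤ D) (j : ℕ) :
    shift p j = ∑ i ∈ Finset.range (D + 1), C (p.coeff i) * (X + C (j : ℂ)) ^ i := by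
  rw [shift, comp, eval₂_eq_sum, sum_over_range' _ (by simp) (D + 1) (by omega)]

theorem natDegree_part_le (k : ℕ) (L : Operator) : (part k L).natDegree ≤ L.natDegree := by
  rw [natDegree_le_iff_coeff_eq_zero]
  intro i hi
  rw [coeff_part, coeff_eq_zero_of_natDegree_lt hi, map_zero]

/-- Moving `tʲ` to the left through `p(ε)` turns it into `p(ε+j)`. This reduces the operator
equation to identities between commuting polynomials. -/
theorem part_opMul (m : ℕ) (P Q : Operator) :
    part m (opMul P Q) =
      ∑ x ∈ Finset.HasAntidiagonal.antidiagonal m, shift (part x.1 P) x.2 * part x.2 Q := by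
  rw [opMul, sum_over_range _ (by simp), map_sum]
  simp_rw [part_smul, part_epsMul_iterate, shift_eq_sum (natDegree_part_le _ P), Finset.sum_mul]
  rw [Finset.sum_comm]
  simp [coeff_part, mul_assoc]

/-- The operator of order at most `D` with given homogeneous components. -/
def ofParts (D : ℕ) (h : ℕ → ℂ[X]) : Operator :=
  ∑ i ∈ Finset.range (D + 1), monomial i (PowerSeries.mk fun k => (h k).coeff i)

theorem coeff_ofParts {D : ℕ} {h : ℕ → ℂ[X]} (hD : ∀ k, (h k).natDegree ≤ D) (i : ℕ) :
    (ofParts D h).coeff i = PowerSeries.mk fun k => (h k).coeff i := by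
  simp only [ofParts, finsetSum_coeff, coeff_monomial]
  rw [Finset.sum_ite_eq']
  split_ifs with hi
  · rfl
  · ext k
    rw [Finset.mem_range] at hi
    simp [coeff_eq_zero_of_natDegree_lt (show (h k).natDegree < i by have := hD k; omega)]

theorem part_ofParts {D : ℕ} {h : ℕ → ℂ[X]} (hD : ∀ k, (h k).natDegree ≤ D) (k : ℕ) :
    part k (ofParts D h) = h k := by
  ext i
  simp [coeff_part, coeff_ofParts hD]

theorem natDegree_eq_of_eulerPart {L : Operator} {D : ℕ} (h : L.natDegree ≤ D)
    (h0 : (eulerPart L).coeff D ≠ 0) : L.natDegree = D := by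
  refine le_antisymm h (le_natDegree_of_ne_zero fun h1 => h0 ?_)
  simp [eulerPart, h1]

/-! ### The submultiplicative ℓ¹ norm on polynomials and its behaviour under shifts. -/

/-- The sum of the absolute values of the coefficients of a polynomial. -/
def coeffNorm (p : ℂ[X]) : ℝ := p.sum fun _ a => ‖a‖

theorem coeffNorm_eq_sum {p : ℂ[X]} {D : ℕ} (h : p.natDegree ≤ D) :
    coeffNorm p = ∑ i ∈ Finset.range (D + 1), ‖p.coeff i‖ :=
  sum_over_range' _ (by simp) (D + 1) (by omega)

theorem coeffNorm_nonneg (p : ℂ[X]) : 0 ≤ coeffNorm p :=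
  Finset.sum_nonneg fun _ _ => norm_nonneg _

theorem norm_coeff_le (p : ℂ[X]) (i : ℕ) : ‖p.coeff i‖ ≤ coeffNorm p := by
  by_cases h : i ∈ p.support
  · exact Finset.single_le_sum (f := fun i => ‖p.coeff i‖) (fun _ _ => norm_nonneg _) h
  · rw [notMem_support_iff.mp h, norm_zero]
    exact coeffNorm_nonneg p

@[simp] theorem coeffNorm_zero : coeffNorm 0 = 0 := by simp [coeffNorm]

theorem coeffNorm_add_le (p q : ℂ[X]) : coeffNorm (p + q) ≤ coeffNorm p + coeffNorm q := by
  rw [coeffNorm_eq_sum (le_max_left p.natDegree q.natDegree),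
    coeffNorm_eq_sum (le_max_right p.natDegree q.natDegree),
    coeffNorm_eq_sum (natDegree_add_le p q), ← Finset.sum_add_distrib]
  refine Finset.sum_le_sum fun i _ => ?_
  rw [coeff_add]
  exact norm_add_le _ _

theorem coeffNorm_C_mul (a : ℂ) (p : ℂ[X]) : coeffNorm (C a * p) = ‖a‖ * coeffNorm p := by
  rw [coeffNorm_eq_sum (natDegree_C_mul_le a p), coeffNorm_eq_sum le_rfl, Finset.mul_sum]
  simp

@[simp] theorem coeffNorm_neg (p : ℂ[X]) : coeffNorm (-p) = coeffNorm p := by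
  simpa using coeffNorm_C_mul (-1) p

theorem coeffNorm_sub_le (p q : ℂ[X]) : coeffNorm (p - q) ≤ coeffNorm p + coeffNorm q := by
  simpa [sub_eq_add_neg] using coeffNorm_add_le p (-q)

theorem coeffNorm_sum_le {ι : Type*} (s : Finset ι) (f : ι → ℂ[X]) :
    coeffNorm (∑ i ∈ s, f i) ≤ ∑ i ∈ s, coeffNorm (f i) :=
  Finset.le_sum_of_subadditive _ coeffNorm_zero.le coeffNorm_add_le _ _

theorem coeffNorm_X_mul (p : ℂ[X]) : coeffNorm (X * p) = coeffNorm p := by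
  have h : (X * p).natDegree ≤ p.natDegree + 1 :=
    natDegree_mul_le.trans (by rw [natDegree_X]; omega)
  rw [coeffNorm_eq_sum h, coeffNorm_eq_sum le_rfl, Finset.sum_range_succ']
  simp

theorem coeffNorm_X_pow_mul (i : ℕ) (p : ℂ[X]) : coeffNorm (X ^ i * p) = coeffNorm p := by
  induction i with
  | zero => simp
  | succ i ih => rw [pow_succ', mul_assoc, coeffNorm_X_mul, ih]

theorem coeffNorm_C (a : ℂ) : coeffNorm (C a) = ‖a‖ := by
  rw [coeffNorm_eq_sum (natDegree_C a).le]; simp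

theorem coeffNorm_map_le (T : ℂ[X] →ₗ[ℂ] ℂ[X]) {p : ℂ[X]} {B : ℝ} {D : ℕ} (hp : p.natDegree ≤ D)
    (h : ∀ i ≤ D, coeffNorm (T (X ^ i)) ≤ B) : coeffNorm (T p) ≤ B * coeffNorm p := by
  conv_lhs => rw [p.as_sum_range' (D + 1) (by omega), map_sum]
  refine (coeffNorm_sum_le _ _).trans ?_
  rw [coeffNorm_eq_sum hp, Finset.mul_sum]
  refine Finset.sum_le_sum fun i hi => ?_
  rw [← mul_one (p.coeff i), ← smul_eq_mul, ← smul_monomial, map_smul, smul_eq_C_mul,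
    coeffNorm_C_mul, monomial_one_right_eq_X_pow, mul_comm, smul_eq_mul, mul_one]
  exact mul_le_mul_of_nonneg_right (h i (by simpa [Nat.lt_succ_iff] using hi)) (norm_nonneg _)

theorem exists_coeffNorm_map_le (T : ℂ[X] →ₗ[ℂ] ℂ[X]) (D : ℕ) :
    ∃ B : ℝ, 0 ≤ B ∧ ∀ p : ℂ[X], p.natDegree ≤ D → coeffNorm (T p) ≤ B * coeffNorm p :=
  ⟨∑ i ∈ Finset.range (D + 1), coeffNorm (T (X ^ i)),
    Finset.sum_nonneg fun _ _ => coeffNorm_nonneg _, fun _ hp => coeffNorm_map_le T hp fun i hi =>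
      Finset.single_le_sum (f := fun i => coeffNorm (T (X ^ i)))
        (fun _ _ => coeffNorm_nonneg _) (Finset.mem_range.2 (by omega))⟩

theorem coeffNorm_mul_le (p q : ℂ[X]) : coeffNorm (p * q) ≤ coeffNorm p * coeffNorm q := by
  have := coeffNorm_map_le (LinearMap.mulRight ℂ q) (p := p) (B := coeffNorm q) le_rfl
    (fun i _ => by simp [coeffNorm_X_pow_mul])
  simpa [mul_comm] using this

theorem coeffNorm_X_add_C_pow_le (j i : ℕ) :
    coeffNorm ((X + C (j : ℂ)) ^ i) ≤ (1 + j : ℝ) ^ i := by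
  induction i with
  | zero => simpa using (coeffNorm_C 1).le
  | succ i ih =>
    have h : coeffNorm (X + C (j : ℂ)) ≤ 1 + j := by
      refine (coeffNorm_add_le _ _).trans (add_le_add ?_ ?_)
      · have := coeffNorm_X_mul (C 1)
        rw [coeffNorm_C] at this
        simpa using this.le
      · rw [coeffNorm_C, Complex.norm_natCast]
    rw [pow_succ, pow_succ]
    exact (coeffNorm_mul_le _ _).trans (by gcongr; exact coeffNorm_nonneg _)

theorem natDegree_shift (p : ℂ[X]) (j : ℕ) : (shift p j).natDegree = p.natDegree := by
  rw [shift, natDegree_comp, natDegree_X_add_C, mul_one]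

theorem coeffNorm_shift_le {p : ℂ[X]} {D : ℕ} (hp : p.natDegree ≤ D) (j : ℕ) :
    coeffNorm (shift p j) ≤ (1 + j : ℝ) ^ D * coeffNorm p := by
  rw [shift_eq_sum hp, coeffNorm_eq_sum hp, Finset.mul_sum]
  refine (coeffNorm_sum_le _ _).trans (Finset.sum_le_sum fun i hi => ?_)
  rw [coeffNorm_C_mul, mul_comm]
  have hi' : i ≤ D := by simpa [Nat.lt_succ_iff] using hi
  have : (1 + j : ℝ) ^ i ≤ (1 + j : ℝ) ^ D := pow_le_pow_right₀ (by simp) hi'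
  gcongr
  exact (coeffNorm_X_add_C_pow_le j i).trans this

/-- Every term other than `mⁿ` loses at least one power of `m`. The factor `m` on the left avoids
the exponent `n - 1`, which would misbehave at `n = 0`. -/
theorem exists_coeffNorm_pow_sub_le (n : ℕ) : ∃ B : ℝ, ∀ m : ℕ, 1 ≤ m →
    m * coeffNorm ((X + C (m : ℂ)) ^ n - C ((m : ℂ) ^ n)) ≤ B * (m : ℝ) ^ n := by
  induction n with
  | zero => exact ⟨0, fun m _ => by simp⟩
  | succ n ih =>
    obtain ⟨B, hB⟩ := ih
    refine ⟨2 * B + 1, fun m hm => ?_⟩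
    have hm' : (1 : ℝ) ≤ m := by exact_mod_cast hm
    have e : (X + C (m : ℂ)) ^ (n + 1) - C ((m : ℂ) ^ (n + 1)) =
        (X + C (m : ℂ)) ^ 1 * ((X + C (m : ℂ)) ^ n - C ((m : ℂ) ^ n)) +
          X * C ((m : ℂ) ^ n) := by
      simp only [C_pow]; ring
    have h1 := (coeffNorm_mul_le ((X + C (m : ℂ)) ^ 1)
      ((X + C (m : ℂ)) ^ n - C ((m : ℂ) ^ n))).trans
        (mul_le_mul_of_nonneg_right (coeffNorm_X_add_C_pow_le m 1) (coeffNorm_nonneg _))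
    have h2 := coeffNorm_add_le ((X + C (m : ℂ)) ^ 1 * ((X + C (m : ℂ)) ^ n - C ((m : ℂ) ^ n)))
      (X * C ((m : ℂ) ^ n))
    rw [← e, coeffNorm_X_mul, coeffNorm_C, norm_pow, Complex.norm_natCast] at h2
    have h3 := hB m hm
    set N := coeffNorm ((X + C (m : ℂ)) ^ n - C ((m : ℂ) ^ n))
    have hN : 0 ≤ N := coeffNorm_nonneg _
    calc _ ≤ m * ((1 + m) ^ 1 * N + (m : ℝ) ^ n) := by gcongr; linarith
      _ = (1 + m) * (m * N) + (m : ℝ) ^ (n + 1) := by ring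
      _ ≤ (2 * m) * (m * N) + (m : ℝ) ^ (n + 1) := by gcongr; linarith
      _ ≤ (2 * m) * (B * (m : ℝ) ^ n) + (m : ℝ) ^ (n + 1) := by gcongr
      _ = _ := by ring

theorem exists_coeffNorm_shift_sub_le (p : ℂ[X]) : ∃ B : ℝ, ∀ m : ℕ, 1 ≤ m →
    m * coeffNorm (shift p m - C (p.leadingCoeff * (m : ℂ) ^ p.natDegree)) ≤
      B * (m : ℝ) ^ p.natDegree := by
  obtain ⟨B, hB⟩ := exists_coeffNorm_pow_sub_le p.natDegree
  refine ⟨∑ i ∈ Finset.range p.natDegree, ‖p.coeff i‖ * 2 ^ i + ‖p.leadingCoeff‖ * B,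
    fun m hm => ?_⟩
  have hm' : (1 : ℝ) ≤ m := by exact_mod_cast hm
  rw [shift_eq_sum le_rfl, Finset.sum_range_succ, C_mul, add_sub_assoc, coeff_natDegree, ← mul_sub,
    add_mul]
  calc _ ≤ (m : ℝ) * (∑ i ∈ Finset.range p.natDegree,
        coeffNorm (C (p.coeff i) * (X + C (m : ℂ)) ^ i) + coeffNorm (C p.leadingCoeff *
          ((X + C (m : ℂ)) ^ p.natDegree - C ((m : ℂ) ^ p.natDegree)))) := by
        gcongr
        exact (coeffNorm_add_le _ _).trans (add_le_add_left (coeffNorm_sum_le _ _) _)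
    _ = ∑ i ∈ Finset.range p.natDegree, m * (‖p.coeff i‖ * coeffNorm ((X + C (m : ℂ)) ^ i)) +
        ‖p.leadingCoeff‖ * (m * coeffNorm
          ((X + C (m : ℂ)) ^ p.natDegree - C ((m : ℂ) ^ p.natDegree))) := by
        simp only [coeffNorm_C_mul, mul_add, Finset.mul_sum]; ring
    _ ≤ _ := by
        rw [Finset.sum_mul, mul_assoc ‖p.leadingCoeff‖]
        refine add_le_add (Finset.sum_le_sum fun i hi => ?_)
          (mul_le_mul_of_nonneg_left (hB m hm) (norm_nonneg _))
        have hi : i + 1 ≤ p.natDegree := by simpa using hi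
        calc _ ≤ m * (‖p.coeff i‖ * (1 + m) ^ i) := by
              gcongr; exact coeffNorm_X_add_C_pow_le m i
          _ ≤ m * (‖p.coeff i‖ * (2 * m) ^ i) := by gcongr; linarith
          _ = ‖p.coeff i‖ * 2 ^ i * m ^ (i + 1) := by ring
          _ ≤ _ := by gcongr

/-! ### Geometric growth and convergence. -/

/-- The sequence grows at most like a geometric progression. -/
def GeometricallyBounded (x : ℕ → ℝ) : Prop :=
  ∃ A R : ℝ, 0 < A ∧ 0 < R ∧ ∀ k, x k ≤ A * R ^ k

namespace GeometricallyBounded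

theorem mono {x y : ℕ → ℝ} (hy : GeometricallyBounded y) (h : ∀ k, x k ≤ y k) :
    GeometricallyBounded x := by
  obtain ⟨A, R, hA, hR, hx⟩ := hy
  exact ⟨A, R, hA, hR, fun k => (h k).trans (hx k)⟩

theorem add {x y : ℕ → ℝ} (hx : GeometricallyBounded x) (hy : GeometricallyBounded y) :
    GeometricallyBounded fun k => x k + y k := by
  obtain ⟨A, R, hA, hR, hx⟩ := hx
  obtain ⟨B, S, hB, hS, hy⟩ := hy
  refine ⟨A + B, max R S, by positivity, by positivity, fun k => ?_⟩
  rw [add_mul]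
  refine add_le_add ((hx k).trans ?_) ((hy k).trans ?_)
  · gcongr; exact le_max_left R S
  · gcongr; exact le_max_right R S

theorem zero : GeometricallyBounded fun _ => 0 :=
  ⟨1, 1, one_pos, one_pos, fun k => by simp⟩

theorem sum {ι : Type*} (s : Finset ι) {x : ι → ℕ → ℝ}
    (h : ∀ i ∈ s, GeometricallyBounded (x i)) : GeometricallyBounded fun k => ∑ i ∈ s, x i k := by
  classical
  induction s using Finset.induction_on with
  | empty => simpa using zero
  | insert a s ha ih =>
    simp only [Finset.sum_insert ha]
    exact (h a (by simp)).add (ih fun i hi => h i (by simp [hi]))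

theorem one_add_pow_mul {x : ℕ → ℝ} (hx : GeometricallyBounded x) (D : ℕ) :
    GeometricallyBounded fun k => (1 + k : ℝ) ^ D * x k := by
  obtain ⟨A, R, hA, hR, hx⟩ := hx
  refine ⟨A, 2 ^ D * R, hA, by positivity, fun k => ?_⟩
  have h : (1 + k : ℝ) ≤ 2 ^ k := by
    rw [add_comm]
    exact_mod_cast Nat.succ_le_of_lt (Nat.lt_two_pow_self (n := k))
  calc _ ≤ (1 + k : ℝ) ^ D * (A * R ^ k) :=
        mul_le_mul_of_nonneg_left (hx k) (by positivity)
    _ ≤ (2 ^ k) ^ D * (A * R ^ k) := by gcongr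
    _ = _ := by rw [mul_pow, ← pow_mul, ← pow_mul, mul_comm k D]; ring

theorem of_eventually_zero {x : ℕ → ℝ} (h0 : ∀ k, 0 ≤ x k) (N : ℕ) (h : ∀ k, N < k → x k = 0) :
    GeometricallyBounded x := by
  refine ⟨∑ i ∈ Finset.range (N + 1), x i + 1, 1,
    add_pos_of_nonneg_of_pos (Finset.sum_nonneg fun i _ => h0 i) one_pos, one_pos, fun k => ?_⟩
  have hs : 0 ≤ ∑ i ∈ Finset.range (N + 1), x i := Finset.sum_nonneg fun i _ => h0 i
  rw [one_pow, mul_one]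
  by_cases hk : N < k
  · rw [h k hk]; positivity
  · have := Finset.single_le_sum (f := x) (fun i _ => h0 i)
      (Finset.mem_range.2 (show k < N + 1 by omega))
    linarith

/-- A discrete Gronwall lemma, by comparison with a multiple of `S ^ k`. -/
theorem of_convolution_le {c z : ℕ → ℝ} (hc : GeometricallyBounded c) (hz : ∀ k, 0 ≤ z k)
    {C : ℝ} {m₀ : ℕ} (hC : 0 ≤ C)
    (h : ∀ m, m₀ ≤ m → z m ≤ C * ∑ i ∈ Finset.range m, c (m - i) * z i) :
    GeometricallyBounded z := by
  obtain ⟨A, R, hA, hR, hc⟩ := hc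
  -- This ratio makes the convolution of `A * R ^ k` with `S ^ k` telescope to `S ^ m - R ^ m`, so
  -- the inductive bound reproduces itself.
  set S := R * (1 + C * A) with hS
  have hS0 : 0 < S := by positivity
  have geom : ∀ m : ℕ, C * ∑ i ∈ Finset.range m, A * R ^ (m - i) * S ^ i = S ^ m - R ^ m := by
    intro m
    induction m with
    | zero => simp
    | succ m ih =>
      rw [Finset.sum_range_succ]
      have e : ∑ i ∈ Finset.range m, A * R ^ (m + 1 - i) * S ^ i =
          R * ∑ i ∈ Finset.range m, A * R ^ (m - i) * S ^ i := by
        rw [Finset.mul_sum]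
        refine Finset.sum_congr rfl fun i hi => ?_
        rw [Nat.succ_sub (Finset.mem_range.1 hi).le, pow_succ]; ring
      rw [e, mul_add, mul_left_comm, ih, pow_succ S, pow_succ R, Nat.add_sub_cancel_left, hS]
      ring
  -- Large enough to cover the indices below `m₀`, where the inequality is not available.
  set B := ∑ i ∈ Finset.range m₀, z i / S ^ i + 1 with hB
  have hB0 : 0 < B :=
    add_pos_of_nonneg_of_pos (Finset.sum_nonneg fun i _ => div_nonneg (hz i) (by positivity))
      one_pos
  refine ⟨B, S, hB0, hS0, fun k => ?_⟩
  induction k using Nat.strong_induction_on with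
  | _ k ih =>
    by_cases hk : k < m₀
    · have := Finset.single_le_sum (f := fun i => z i / S ^ i)
        (fun i _ => div_nonneg (hz i) (by positivity)) (Finset.mem_range.2 hk)
      rw [← div_le_iff₀ (by positivity)]
      linarith
    · calc z k ≤ C * ∑ i ∈ Finset.range k, c (k - i) * z i := h k (by omega)
        _ ≤ C * ∑ i ∈ Finset.range k, (A * R ^ (k - i)) * (B * S ^ i) := by
          gcongr with i hi
          · exact hz i
          · exact hc _
          · exact ih i (Finset.mem_range.1 hi)
        _ = B * (C * ∑ i ∈ Finset.range k, A * R ^ (k - i) * S ^ i) := by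
          simp only [Finset.mul_sum]
          exact Finset.sum_congr rfl fun i _ => by ring
        _ ≤ B * S ^ k := by
          rw [geom]
          gcongr
          have : 0 ≤ R ^ k := by positivity
          linarith

end GeometricallyBounded

theorem isConvergent_iff (a : PowerSeries ℂ) :
    IsConvergent a ↔ GeometricallyBounded fun k => ‖PowerSeries.coeff k a‖ := by
  constructor
  · rintro ⟨r, hr, hs⟩
    refine ⟨∑' k, ‖PowerSeries.coeff k a‖ * r ^ k + 1, r⁻¹,
      add_pos_of_nonneg_of_pos (tsum_nonneg fun k => by positivity) one_pos, by positivity,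
      fun k => ?_⟩
    rw [inv_pow, ← div_eq_mul_inv, le_div_iff₀ (by positivity)]
    have := hs.le_tsum k fun j _ => by positivity
    linarith
  · rintro ⟨A, R, hA, hR, h⟩
    refine ⟨(2 * R)⁻¹, by positivity, ?_⟩
    refine Summable.of_nonneg_of_le (fun k => by positivity) (fun k => ?_)
      ((summable_geometric_of_lt_one (r := 1 / 2) (by norm_num) (by norm_num)).mul_left A)
    calc _ ≤ A * R ^ k * (2 * R)⁻¹ ^ k := by gcongr; exact h k
      _ = A * (R * (2 * R)⁻¹) ^ k := by rw [mul_pow]; ring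
      _ = A * (1 / 2) ^ k := by congr 2; field_simp

theorem geometricallyBounded_part {L : Operator} (hL : ∀ i, IsConvergent (L.coeff i)) :
    GeometricallyBounded fun k => coeffNorm (part k L) := by
  refine (GeometricallyBounded.sum (Finset.range (L.natDegree + 1)) fun i _ =>
    (isConvergent_iff _).1 (hL i)).mono fun k => ?_
  rw [coeffNorm_eq_sum (natDegree_part_le k L)]
  simp [coeff_part]

theorem isFuchsian_ofParts {D : ℕ} {h : ℕ → ℂ[X]} (hD : ∀ k, (h k).natDegree ≤ D)
    (h0 : (h 0).coeff D ≠ 0) (hb : GeometricallyBounded fun k => coeffNorm (h k)) :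
    IsFuchsian (ofParts D h) := by
  have hdeg : (ofParts D h).natDegree = D := by
    refine natDegree_eq_of_eulerPart (natDegree_sum_le_of_forall_le _ _ fun i hi => ?_) ?_
    · exact (natDegree_monomial_le _).trans (by simpa [Nat.lt_succ_iff] using hi)
    · rwa [← part_zero_eq_eulerPart, part_ofParts hD]
  refine ⟨fun i => (isConvergent_iff _).2 (hb.mono fun k => ?_), ?_⟩
  · rw [coeff_ofParts hD, PowerSeries.coeff_mk]
    exact norm_coeff_le _ _
  · rw [leadingCoeff, hdeg, coeff_ofParts hD, ← PowerSeries.coeff_zero_eq_constantCoeff_apply,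
      PowerSeries.coeff_mk]
    exact h0

/-! ### Division by the Euler part with uniform bounds. -/

theorem exists_linear_mod {p : ℂ[X]} (hp : p ≠ 0) : ∃ T : ℂ[X] →ₗ[ℂ] ℂ[X],
    (∀ f, T (p * f) = 0) ∧ ∀ f : ℂ[X], f.degree < p.degree → T f = f := by
  have hm : (p * C p.leadingCoeff⁻¹).Monic := monic_mul_leadingCoeff_inv hp
  refine ⟨modByMonicHom (p * C p.leadingCoeff⁻¹), fun f => ?_, fun f hf => ?_⟩
  · refine (modByMonic_eq_zero_iff_dvd hm).2 ⟨C p.leadingCoeff * f, ?_⟩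
    rw [mul_assoc, ← mul_assoc (C _), ← C_mul, inv_mul_cancel₀ (leadingCoeff_ne_zero.2 hp), C_1,
      one_mul]
  · refine (modByMonic_eq_self_iff hm).2 ?_
    rwa [degree_mul_leadingCoeff_inv p hp]

theorem exists_linear_div {p : ℂ[X]} (hp : p ≠ 0) : ∃ T : ℂ[X] →ₗ[ℂ] ℂ[X],
    ∀ f, T (p * f) = f := by
  obtain ⟨T, hT⟩ := (LinearMap.mulLeft ℂ p).exists_leftInverse_of_injective
    (LinearMap.ker_eq_bot.2 (mul_right_injective₀ hp))
  exact ⟨T, fun f => LinearMap.congr_fun hT f⟩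

/-- Write `p(ε+m) = c mⁿ + r`, with `r` smaller than the main term by a factor of order `m`.
Reduction modulo `p` is bounded on polynomials of degree at most `D`, so for large `m` the
contribution of `r * h` is absorbed by half of `c mⁿ h`. -/
theorem exists_coeffNorm_remainder_le {p : ℂ[X]} (hp : p ≠ 0) {D : ℕ}
    (hD : 2 * p.natDegree ≤ D) :
    ∃ B : ℝ, 0 ≤ B ∧ ∃ m₀ : ℕ, ∀ m, m₀ ≤ m → ∀ g h : ℂ[X], g.natDegree ≤ D →
      h.degree < p.degree → p ∣ shift p m * h - g →
      (1 + m : ℝ) ^ p.natDegree * coeffNorm h ≤ B * coeffNorm g := by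
  obtain ⟨T, hT0, hT⟩ := exists_linear_mod hp
  obtain ⟨B, hB, hTB⟩ := exists_coeffNorm_map_le T D
  obtain ⟨E, hE⟩ := exists_coeffNorm_shift_sub_le p
  set n := p.natDegree with hn
  set c := p.leadingCoeff with hc
  have hc0 : 0 < ‖c‖ := norm_pos_iff.2 (leadingCoeff_ne_zero.2 hp)
  -- Beyond this threshold `B * coeffNorm r` is at most half of `‖c‖ mⁿ`.
  obtain ⟨m₁, hm₁⟩ := exists_nat_ge (2 * B * E / ‖c‖)
  refine ⟨2 ^ n * (2 * B / ‖c‖), by positivity, max 1 m₁, fun m hm g h hg hh hd => ?_⟩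
  have hm1 : (1 : ℝ) ≤ m := by exact_mod_cast (le_max_left 1 m₁).trans hm
  have hm2 : 2 * B * E ≤ m * ‖c‖ := by
    rw [← div_le_iff₀ hc0]
    exact hm₁.trans (by exact_mod_cast (le_max_right 1 m₁).trans hm)
  set r := shift p m - C (c * (m : ℂ) ^ n) with hr
  have hrB : B * coeffNorm r ≤ ‖c‖ * (m : ℝ) ^ n / 2 := by
    have h1 := mul_le_mul_of_nonneg_left (hE m ((le_max_left 1 m₁).trans hm)) hB
    have h2 : 2 * B * E * (m : ℝ) ^ n ≤ m * ‖c‖ * (m : ℝ) ^ n := by gcongr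
    have h3 : (m : ℝ) * (2 * (B * coeffNorm r)) ≤ m * (‖c‖ * (m : ℝ) ^ n) := by linarith
    have := le_of_mul_le_mul_left h3 (by linarith)
    linarith
  have hhn : h.natDegree ≤ n := natDegree_le_natDegree hh.le
  have hrn : r.natDegree ≤ n :=
    (natDegree_sub_le _ _).trans (max_le (natDegree_shift p m).le (by rw [natDegree_C]; omega))
  have key : C (c * (m : ℂ) ^ n) * h = T g - T (r * h) := by
    obtain ⟨f, hf⟩ := hd
    have e : C (c * (m : ℂ) ^ n) * h = p * f + g - r * h := by rw [← hf, hr]; ring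
    have e2 : T (C (c * (m : ℂ) ^ n) * h) = C (c * (m : ℂ) ^ n) * h := by
      rw [← smul_eq_C_mul, map_smul, hT h hh]
    rw [← e2, e, map_sub, map_add, hT0, zero_add]
  have h1 : ‖c‖ * (m : ℝ) ^ n * coeffNorm h ≤
      B * coeffNorm g + B * coeffNorm r * coeffNorm h := by
    have h2 := coeffNorm_sub_le (T g) (T (r * h))
    rw [← key, coeffNorm_C_mul, norm_mul, norm_pow, Complex.norm_natCast] at h2
    refine h2.trans (add_le_add (hTB g hg) ((hTB _ (natDegree_mul_le.trans (by omega))).trans ?_))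
    rw [mul_assoc]
    gcongr
    exact coeffNorm_mul_le _ _
  have h2 := mul_le_mul_of_nonneg_right hrB (coeffNorm_nonneg h)
  have h3 : (m : ℝ) ^ n * coeffNorm h ≤ 2 * B / ‖c‖ * coeffNorm g := by
    rw [div_mul_eq_mul_div, le_div_iff₀ hc0]
    linarith
  calc (1 + m : ℝ) ^ n * coeffNorm h ≤ (2 * m) ^ n * coeffNorm h := by
        gcongr
        · exact coeffNorm_nonneg h
        · linarith
    _ = 2 ^ n * (m ^ n * coeffNorm h) := by ring
    _ ≤ 2 ^ n * (2 * B / ‖c‖ * coeffNorm g) := by gcongr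
    _ = _ := by ring

theorem exists_coeffNorm_division_le {p : ℂ[X]} (hp : p ≠ 0) {D : ℕ}
    (hD : 2 * p.natDegree ≤ D) :
    ∃ B : ℝ, 0 ≤ B ∧ ∃ m₀ : ℕ, ∀ m, m₀ ≤ m → ∀ g h k : ℂ[X], g.natDegree ≤ D →
      h.degree < p.degree → shift p m * h - g = p * k →
      coeffNorm k + (1 + m : ℝ) ^ p.natDegree * coeffNorm h ≤ B * coeffNorm g := by
  obtain ⟨B, hB, m₀, h₀⟩ := exists_coeffNorm_remainder_le hp hD
  obtain ⟨T, hT⟩ := exists_linear_div hp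
  obtain ⟨B', hB', hTB⟩ := exists_coeffNorm_map_le T D
  refine ⟨B' * (coeffNorm p * B + 1) + B, by have := coeffNorm_nonneg p; positivity, m₀,
    fun m hm g h k hg hh hk => ?_⟩
  have h1 := h₀ m hm g h hg hh ⟨k, hk⟩
  have h2 : coeffNorm k ≤ B' * (coeffNorm p * (B * coeffNorm g) + coeffNorm g) := by
    rw [← hT k, ← hk]
    refine (hTB _ ?_).trans ?_
    · refine (natDegree_sub_le _ _).trans (max_le (natDegree_mul_le.trans ?_) hg)
      have := natDegree_le_natDegree hh.le
      rw [natDegree_shift]; omega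
    · gcongr
      refine (coeffNorm_sub_le _ _).trans (add_le_add_left ((coeffNorm_mul_le _ _).trans ?_) _)
      calc _ ≤ (1 + m : ℝ) ^ p.natDegree * coeffNorm p * coeffNorm h := by
            gcongr
            · exact coeffNorm_nonneg h
            · exact coeffNorm_shift_le le_rfl m
        _ = coeffNorm p * ((1 + m : ℝ) ^ p.natDegree * coeffNorm h) := by ring
        _ ≤ _ := mul_le_mul_of_nonneg_left h1 (coeffNorm_nonneg p)
  linarith

/-! ### Convergence of the conjugating operators. -/

theorem geometricallyBounded_of_conjugation {p₀ : ℂ[X]} (hp₀ : p₀ ≠ 0) {D : ℕ}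
    {p q h k : ℕ → ℂ[X]} (hp : ∀ m, (p m).natDegree ≤ D) (hq : ∀ m, (q m).natDegree ≤ p₀.natDegree)
    (hh : ∀ m, (h m).natDegree ≤ D) (hk : ∀ m, (k m).natDegree ≤ D)
    (hh' : ∀ m, 1 ≤ m → (h m).degree < p₀.degree)
    (hpb : GeometricallyBounded fun m => coeffNorm (p m))
    (hqb : GeometricallyBounded fun m => coeffNorm (q m))
    (heq : ∀ m, 1 ≤ m → shift p₀ m * h m + ∑ i ∈ Finset.range m, shift (q (m - i)) i * h i =
      p₀ * k m + ∑ i ∈ Finset.range m, shift (k i) (m - i) * p (m - i)) :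
    GeometricallyBounded (fun m => coeffNorm (h m)) ∧
      GeometricallyBounded fun m => coeffNorm (k m) := by
  obtain ⟨B, hB, m₀, h₀⟩ := exists_coeffNorm_division_le hp₀
    (le_max_left (2 * p₀.natDegree) (2 * D + p₀.natDegree))
  -- The weight on `h i` absorbs the factor `(1 + i)ⁿ` from shifting `q (m - i)` by `i`. Shifting `k
  -- i` by `m - i` costs a factor depending only on `m - i`, which goes into the convolution kernel.
  set z : ℕ → ℝ := fun m => coeffNorm (k m) + (1 + m : ℝ) ^ p₀.natDegree * coeffNorm (h m) with hz
  have hy0 : ∀ m : ℕ, 0 ≤ (1 + m : ℝ) ^ p₀.natDegree * coeffNorm (h m) := fun m =>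
    mul_nonneg (by positivity) (coeffNorm_nonneg _)
  have hzb : GeometricallyBounded z := by
    refine GeometricallyBounded.of_convolution_le ((hpb.one_add_pow_mul D).add hqb)
      (fun m => add_nonneg (coeffNorm_nonneg _) (hy0 m)) hB (m₀ := max 1 m₀) fun m hm => ?_
    refine (h₀ m ((le_max_right _ _).trans hm)
      (∑ i ∈ Finset.range m, (shift (k i) (m - i) * p (m - i) - shift (q (m - i)) i * h i)) (h m)
      (k m) ?_ (hh' m ((le_max_left _ _).trans hm)) ?_).trans ?_
    · refine natDegree_sum_le_of_forall_le _ _ fun i _ => (natDegree_sub_le _ _).trans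
        ((max_le ?_ ?_).trans (le_max_right _ _))
      · refine natDegree_mul_le.trans ?_
        rw [natDegree_shift]
        have := hk i; have := hp (m - i); omega
      · refine natDegree_mul_le.trans ?_
        rw [natDegree_shift]
        have := hh i; have := hq (m - i); omega
    · rw [Finset.sum_sub_distrib]
      linear_combination heq m ((le_max_left _ _).trans hm)
    · refine mul_le_mul_of_nonneg_left ((coeffNorm_sum_le _ _).trans
        (Finset.sum_le_sum fun i _ => ?_)) hB
      have h1 := (coeffNorm_mul_le _ (p (m - i))).trans (mul_le_mul_of_nonneg_right
        (coeffNorm_shift_le (hk i) (m - i)) (coeffNorm_nonneg _))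
      have h2 := (coeffNorm_mul_le _ (h i)).trans (mul_le_mul_of_nonneg_right
        (coeffNorm_shift_le (hq (m - i)) i) (coeffNorm_nonneg _))
      refine (coeffNorm_sub_le _ _).trans ((add_le_add h1 h2).trans ?_)
      have h3 : 0 ≤ (1 + ((m - i : ℕ) : ℝ)) ^ D * coeffNorm (p (m - i)) :=
        mul_nonneg (by positivity) (coeffNorm_nonneg _)
      have h4 := mul_nonneg h3 (hy0 i)
      have h5 := mul_nonneg (coeffNorm_nonneg (q (m - i))) (coeffNorm_nonneg (k i))
      simp only [hz]
      linarith
  refine ⟨hzb.mono fun m => ?_, hzb.mono fun m => le_add_of_nonneg_right (hy0 m)⟩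
  have h1 : 1 ≤ (1 + m : ℝ) ^ p₀.natDegree := one_le_pow₀ (by simp)
  have h2 := mul_le_mul_of_nonneg_right h1 (coeffNorm_nonneg (h m))
  have h3 := coeffNorm_nonneg (k m)
  simp only [hz]
  linarith

/-! ### Formal solution by recursion on the degree in `t`. -/

theorem exists_seq_of_step {α : Type*} [Nonempty α] {P : ℕ → (ℕ → α) → α → Prop}
    (hP : ∀ m f f' a, (∀ j < m, f j = f' j) → P m f a → P m f' a) (h : ∀ m f, ∃ a, P m f a) :
    ∃ f : ℕ → α, ∀ m, P m f (f m) := by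
  classical
  choose step hstep using h
  let ext : (m : ℕ) → ((j : ℕ) → j < m → α) → ℕ → α := fun m ih j =>
    if hj : j < m then ih j hj else Classical.arbitrary α
  let f : ℕ → α := WellFounded.fix Nat.lt_wfRel.wf fun m ih => step m (ext m ih)
  have hf : ∀ m, f m = step m (ext m fun j _ => f j) := fun m => WellFounded.fix_eq _ _ _
  refine ⟨f, fun m => ?_⟩
  rw [hf m]
  refine hP m _ _ _ (fun j hj => ?_) (hstep m (ext m fun j _ => f j))
  simp [ext, hj]

theorem isCoprime_shift_of_maxResonance_lt {p : ℂ[X]} (hp : p ≠ 0) {j : ℕ}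
    (hj : maxResonance p < j) : IsCoprime p (shift p j) := by
  rw [isCoprime_iff_aeval_ne_zero_of_isAlgClosed ℂ ℂ]
  intro a
  by_contra! h
  obtain ⟨h1, h2⟩ := h
  rw [coe_aeval_eq_eval] at h1 h2
  have hmem : j ∈ {j : ℕ | ∃ z : ℂ, p.IsRoot z ∧ p.IsRoot (z + j)} :=
    ⟨a, h1, by simpa [shift, eval_comp] using h2⟩
  refine absurd (le_csSup ?_ hmem) (not_le.2 hj)
  -- Boundedness is essential: `sSup` of an unbounded set of naturals is the default value `0`.
  have hfin : {x | p.IsRoot x}.Finite := p.finite_setOfPred_isRoot hp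
  refine ((Set.Finite.image2 (fun z w : ℂ => w - z) hfin hfin).preimage
    (Nat.cast_injective.injOn (s := _))).subset ?_ |>.bddAbove
  rintro i ⟨z, hz, hw⟩
  exact ⟨z, hz, z + i, hw, by simp⟩

theorem exists_resonance_solution {p : ℂ[X]} (hp : p ≠ 0) {j : ℕ}
    {V : Submodule ℂ (Residues p)} (hV : LinearMap.range (shiftMul p j) ⊔ V = ⊤) (g : ℂ[X]) :
    ∃ h q : ℂ[X], h.degree < p.degree ∧ q.degree < p.degree ∧
      Ideal.Quotient.mk (Ideal.span {p}) q ∈ V ∧ p ∣ shift p j * h + q - g := by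
  have hmod : ∀ f : ℂ[X], Ideal.Quotient.mk (Ideal.span {p}) (f % p) =
      Ideal.Quotient.mk (Ideal.span {p}) f := fun f =>
    Ideal.Quotient.eq.2 (Ideal.mem_span_singleton.2 ((EuclideanDomain.mod_eq_sub_mul_div f p).symm ▸
      ⟨-(f / p), by ring⟩))
  have hg : Ideal.Quotient.mk (Ideal.span {p}) g ∈ LinearMap.range (shiftMul p j) ⊔ V := by
    rw [hV]; trivial
  obtain ⟨_, ⟨x, rfl⟩, v, hv, e⟩ := Submodule.mem_sup.1 hg
  obtain ⟨h, rfl⟩ := Ideal.Quotient.mk_surjective x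
  obtain ⟨q, rfl⟩ := Ideal.Quotient.mk_surjective v
  refine ⟨h % p, q % p, degree_mod_lt h hp, degree_mod_lt q hp, by rwa [hmod], ?_⟩
  rw [← Ideal.mem_span_singleton, ← Ideal.Quotient.eq, map_add, map_mul, hmod, hmod, ← e]
  rfl

theorem range_shiftMul_eq_top {p : ℂ[X]} {j : ℕ} (h : IsCoprime p (shift p j)) :
    LinearMap.range (shiftMul p j) = ⊤ := by
  obtain ⟨a, b, hab⟩ := h
  refine LinearMap.range_eq_top.2 fun x => ?_
  obtain ⟨g, rfl⟩ := Ideal.Quotient.mk_surjective x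
  refine ⟨Ideal.Quotient.mk _ (b * g), ?_⟩
  change Ideal.Quotient.mk _ (shift p j) * Ideal.Quotient.mk _ (b * g) = _
  rw [← map_mul, Ideal.Quotient.eq, Ideal.mem_span_singleton]
  exact ⟨-(a * g), by linear_combination g * hab⟩

/-- A solution of the equation `M ∘ H = K ∘ L`, one homogeneous component at a time, with `M` in
the normal form given by the subspaces `V j`. -/
theorem exists_conjugation_seq {p₀ : ℂ[X]} (hp₀ : p₀ ≠ 0) {V : ℕ → Submodule ℂ (Residues p₀)}
    (hV : IsAffineNormalForm p₀ V) {p : ℕ → ℂ[X]} (hp : ∀ m, (p m).natDegree ≤ p₀.natDegree) :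
    ∃ q h k : ℕ → ℂ[X], q 0 = p₀ ∧ h 0 = p₀ * X + 1 ∧ k 0 = p₀ * X + 1 ∧
      (∀ m, 1 ≤ m → (q m).degree < p₀.degree ∧ (h m).degree < p₀.degree ∧
        Ideal.Quotient.mk (Ideal.span {p₀}) (q m) ∈ V m) ∧
      (∀ m, (k m).natDegree ≤ p₀.natDegree + 1) ∧
      ∀ m, 1 ≤ m → shift p₀ m * h m + ∑ i ∈ Finset.range m, shift (q (m - i)) i * h i =
        p₀ * k m + ∑ i ∈ Finset.range m, shift (k i) (m - i) * p (m - i) := by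
  set n := p₀.natDegree with hn
  -- The degree `n + 1` of `h 0 = k 0` bounds the degrees of all `h m` and `k m`, which keeps the
  -- leading coefficients nonzero at `t = 0`, even for constant `p₀`.
  have hdeg0 : (p₀ * X + 1).natDegree ≤ n + 1 := by
    refine (natDegree_add_le _ _).trans (max_le (natDegree_mul_le.trans ?_) (by simp))
    rw [natDegree_X]
  let P : ℕ → (ℕ → ℂ[X] × ℂ[X] × ℂ[X]) → ℂ[X] × ℂ[X] × ℂ[X] → Prop := fun m f a =>
    (m = 0 → a = (p₀, p₀ * X + 1, p₀ * X + 1)) ∧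
    (1 ≤ m → a.1.degree < p₀.degree ∧ a.2.1.degree < p₀.degree ∧
      Ideal.Quotient.mk (Ideal.span {p₀}) a.1 ∈ V m ∧
      shift p₀ m * a.2.1 + (a.1 * (p₀ * X + 1) +
          ∑ i ∈ Finset.Ico 1 m, shift (f (m - i)).1 i * (f i).2.1) =
        p₀ * a.2.2 + ∑ i ∈ Finset.range m, shift (f i).2.2 (m - i) * p (m - i))
  obtain ⟨f, hf⟩ := exists_seq_of_step (P := P)
    (by
      rintro m f f' a hff ⟨h0, h1⟩
      refine ⟨h0, fun hm => ?_⟩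
      obtain ⟨a1, a2, a3, a4⟩ := h1 hm
      refine ⟨a1, a2, a3, ?_⟩
      have e1 : ∑ i ∈ Finset.Ico 1 m, shift (f' (m - i)).1 i * (f' i).2.1 =
          ∑ i ∈ Finset.Ico 1 m, shift (f (m - i)).1 i * (f i).2.1 :=
        Finset.sum_congr rfl fun i hi => by
          rw [Finset.mem_Ico] at hi
          rw [hff i hi.2, hff (m - i) (by omega)]
      have e2 : ∑ i ∈ Finset.range m, shift (f' i).2.2 (m - i) * p (m - i) =
          ∑ i ∈ Finset.range m, shift (f i).2.2 (m - i) * p (m - i) :=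
        Finset.sum_congr rfl fun i hi => by rw [hff i (Finset.mem_range.1 hi)]
      rw [e1, e2, a4])
    (by
      intro m f
      rcases Nat.eq_zero_or_pos m with rfl | hm
      · exact ⟨_, fun _ => rfl, fun h => absurd h (by simp)⟩
      obtain ⟨h, q, hh, hq, hqV, k, hk⟩ := exists_resonance_solution hp₀ (hV m hm)
        (∑ i ∈ Finset.range m, shift (f i).2.2 (m - i) * p (m - i) -
          ∑ i ∈ Finset.Ico 1 m, shift (f (m - i)).1 i * (f i).2.1)
      -- The summand `q * X` compensates for `q * (p₀ * X + 1) = q + p₀ * (q * X)`.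
      refine ⟨(q, h, k + q * X), fun h0 => absurd h0 (by omega), fun _ => ⟨hq, hh, hqV, ?_⟩⟩
      linear_combination hk)
  have f0 : f 0 = (p₀, p₀ * X + 1, p₀ * X + 1) := (hf 0).1 rfl
  have heq : ∀ m, 1 ≤ m →
      shift p₀ m * (f m).2.1 + ∑ i ∈ Finset.range m, shift (f (m - i)).1 i * (f i).2.1 =
        p₀ * (f m).2.2 + ∑ i ∈ Finset.range m, shift (f i).2.2 (m - i) * p (m - i) := by
    intro m hm
    rw [Finset.range_eq_Ico, Finset.sum_eq_sum_Ico_succ_bot (by omega), ← Finset.range_eq_Ico,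
      Nat.sub_zero, f0, ← ((hf m).2 hm).2.2.2]
    simp [shift]
  refine ⟨fun m => (f m).1, fun m => (f m).2.1, fun m => (f m).2.2, by simp [f0], by simp [f0],
    by simp [f0], fun m hm => ⟨((hf m).2 hm).1, ((hf m).2 hm).2.1, ((hf m).2 hm).2.2.1⟩,
    fun m => ?_, heq⟩
  have hqn : ∀ i, (f i).1.natDegree ≤ n := fun i => by
    rcases Nat.eq_zero_or_pos i with rfl | hi
    · rw [f0]
    · exact natDegree_le_natDegree ((hf i).2 hi).1.le
  have hhn : ∀ i, (f i).2.1.natDegree ≤ n + 1 := fun i => by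
    rcases Nat.eq_zero_or_pos i with rfl | hi
    · rwa [f0]
    · exact (natDegree_le_natDegree ((hf i).2 hi).2.1.le).trans (Nat.le_succ n)
  change (f m).2.2.natDegree ≤ n + 1
  induction m using Nat.strong_induction_on with
  | _ m ih =>
    rcases Nat.eq_zero_or_pos m with rfl | hm
    · rwa [f0]
    by_cases hk0 : (f m).2.2 = 0
    · simp [hk0]
    have h1 : (p₀ * (f m).2.2).natDegree ≤ n + (n + 1) := by
      rw [← sub_eq_iff_eq_add.2 (heq m hm)]
      have hmul : ∀ a b : ℂ[X], ∀ j, a.natDegree + b.natDegree ≤ n + (n + 1) →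
          (shift a j * b).natDegree ≤ n + (n + 1) := fun a b j hab =>
        natDegree_mul_le.trans (by rwa [natDegree_shift])
      refine (natDegree_sub_le _ _).trans (max_le ((natDegree_add_le _ _).trans (max_le ?_ ?_)) ?_)
      · exact hmul _ _ _ (add_le_add le_rfl (hhn m))
      · exact natDegree_sum_le_of_forall_le _ _ fun i _ =>
          hmul _ _ _ (add_le_add (hqn _) (hhn i))
      · refine natDegree_sum_le_of_forall_le _ _ fun i hi => hmul _ _ _ ?_
        have := ih i (Finset.mem_range.1 hi)
        have := hp (m - i)
        omega
    rw [natDegree_mul hp₀ hk0] at h1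
    omega

/-! ### Assembling the operators. -/

theorem part_eulerOp (m : ℕ) (p : ℂ[X]) : part m (eulerOp p) = if m = 0 then p else 0 := by
  ext i
  rw [coeff_part, eulerOp, coeff_map, PowerSeries.coeff_C]
  split_ifs <;> simp

theorem part_X_pow_smul_eulerOp (m j : ℕ) (p : ℂ[X]) :
    part m ((PowerSeries.X ^ j : PowerSeries ℂ) • eulerOp p) = if m = j then p else 0 := by
  ext i
  rw [coeff_part, coeff_smul, smul_eq_mul, PowerSeries.coeff_X_pow_mul', ← coeff_part,
    part_eulerOp]
  split_ifs <;> first | rfl | omega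

theorem part_normalForm {q : ℕ → ℂ[X]} {N : ℕ} (hq : ∀ m, N < m → q m = 0) (m : ℕ) :
    part m (eulerOp (q 0) + ∑ j ∈ Finset.Icc 1 N,
      (PowerSeries.X ^ j : PowerSeries ℂ) • eulerOp (q j)) = q m := by
  rw [map_add, map_sum, part_eulerOp]
  simp only [part_X_pow_smul_eulerOp, Finset.sum_ite_eq, Finset.mem_Icc]
  rcases Nat.eq_zero_or_pos m with rfl | hm
  · simp
  · rcases Nat.lt_or_ge N m with h | h
    · simp [hq m h, hm.ne']
    · simp [hm.ne', h, Nat.one_le_iff_ne_zero]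

theorem natDegree_le_of_part {L : Operator} {D : ℕ} (h : ∀ k, (part k L).natDegree ≤ D) :
    L.natDegree ≤ D := by
  rw [natDegree_le_iff_coeff_eq_zero]
  intro i hi
  ext k
  rw [← coeff_part, coeff_eq_zero_of_natDegree_lt ((h k).trans_lt hi), map_zero]

theorem IsFuchsian.coeff_eulerPart_ne_zero {L : Operator} (hL : IsFuchsian L) :
    (eulerPart L).coeff L.natDegree ≠ 0 := by
  rw [eulerPart, coeff_map]
  exact hL.2

theorem IsFuchsian.natDegree_eulerPart {L : Operator} (hL : IsFuchsian L) :
    (eulerPart L).natDegree = L.natDegree :=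
  le_antisymm natDegree_map_le (le_natDegree_of_ne_zero hL.coeff_eulerPart_ne_zero)

/-- Every Fuchsian operator is equivalent to a polynomial operator in affine normal form. -/
theorem exists_fuchsianEquivalent_normalForm (p₀ : ℂ[X]) (V : ℕ → Submodule ℂ (Residues p₀))
    (hV : IsAffineNormalForm p₀ V)
    (L : Operator) (hL : IsFuchsian L) (hp₀ : eulerPart L = p₀) :
    ∃ q : ℕ → ℂ[X],
      (∀ j ∈ Finset.Icc 1 (maxResonance p₀),
        (q j).degree < p₀.degree ∧
          Ideal.Quotient.mk (Ideal.span {p₀}) (q j) ∈ V j) ∧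
      FuchsianEquivalent L
        (eulerOp p₀ + ∑ j ∈ Finset.Icc 1 (maxResonance p₀),
          (PowerSeries.X ^ j : PowerSeries ℂ) • eulerOp (q j)) := by
  have hLn : p₀.natDegree = L.natDegree := hp₀ ▸ hL.natDegree_eulerPart
  have hc : p₀.coeff p₀.natDegree ≠ 0 := by
    rw [hLn, ← hp₀]
    exact hL.coeff_eulerPart_ne_zero
  have hne : p₀ ≠ 0 := fun h => hc (by simp [h])
  have hpart : ∀ m, (part m L).natDegree ≤ p₀.natDegree := fun m =>
    (natDegree_part_le m L).trans hLn.ge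
  -- Beyond the last resonance the zero subspace suffices. It forces `p₀ ∣ q m` with smaller degree,
  -- hence `q m = 0`.
  have hV' : IsAffineNormalForm p₀ fun j => if j ≤ maxResonance p₀ then V j else ⊥ := by
    intro j hj
    by_cases hjN : j ≤ maxResonance p₀
    · simpa only [if_pos hjN] using hV j hj
    · rw [range_shiftMul_eq_top (isCoprime_shift_of_maxResonance_lt hne (not_le.1 hjN)), top_sup_eq]
  obtain ⟨q, h, k, q0, h0, k0, hqh, hk, heq⟩ := exists_conjugation_seq hne hV' hpart
  have hqN : ∀ m, maxResonance p₀ < m → q m = 0 := fun m hm => by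
    have hm' := hqh m (by omega)
    rw [if_neg (not_le.2 hm), Submodule.mem_bot, Ideal.Quotient.eq_zero_iff_dvd] at hm'
    exact eq_zero_of_dvd_of_degree_lt hm'.2.2 hm'.1
  have hqn : ∀ m, (q m).natDegree ≤ p₀.natDegree := fun m => by
    rcases Nat.eq_zero_or_pos m with rfl | hm
    · rw [q0]
    · exact natDegree_le_natDegree (hqh m hm).1.le
  have hc1 : (p₀ * X + 1).coeff (p₀.natDegree + 1) ≠ 0 := by
    simpa [coeff_one] using hc
  have hhn : ∀ m, (h m).natDegree ≤ p₀.natDegree + 1 := fun m => by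
    rcases Nat.eq_zero_or_pos m with rfl | hm
    · rw [h0, ← k0]
      exact hk 0
    · exact (natDegree_le_natDegree (hqh m hm).2.1.le).trans (Nat.le_succ _)
  obtain ⟨hhb, hkb⟩ := geometricallyBounded_of_conjugation hne
    (fun m => (hpart m).trans (Nat.le_succ _)) hqn hhn hk (fun m hm => (hqh m hm).2.1)
    (geometricallyBounded_part hL.1)
    (GeometricallyBounded.of_eventually_zero (fun _ => coeffNorm_nonneg _) (maxResonance p₀)
      fun m hm => by rw [hqN m hm, coeffNorm_zero]) heq
  have hM := part_normalForm hqN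
  rw [q0] at hM
  refine ⟨q, fun j hj => ?_, ?_, ofParts (p₀.natDegree + 1) h, ofParts (p₀.natDegree + 1) k,
    isFuchsian_ofParts hhn (by rwa [h0]) hhb, isFuchsian_ofParts hk (by rwa [k0]) hkb,
    part_ext fun m => ?_, ?_⟩
  · rw [Finset.mem_Icc] at hj
    have := hqh j hj.1
    rw [if_pos hj.2] at this
    exact ⟨this.1, this.2.2⟩
  · rw [← hLn]
    refine (natDegree_eq_of_eulerPart (natDegree_le_of_part fun m => ?_) ?_).symm
    · rw [hM]
      exact hqn m
    · rwa [← part_zero_eq_eulerPart, hM, q0]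
  · rw [part_opMul, part_opMul]
    simp only [hM, part_ofParts hhn, part_ofParts hk]
    rw [← Finset.Nat.sum_antidiagonal_swap]
    simp only [Prod.fst_swap, Prod.snd_swap]
    rw [Finset.Nat.sum_antidiagonal_eq_sum_range_succ fun i j => shift (q j) i * h i,
      Finset.Nat.sum_antidiagonal_eq_sum_range_succ fun i j => shift (k i) j * part j L,
      Finset.sum_range_succ, Finset.sum_range_succ, Nat.sub_self, q0, part_zero_eq_eulerPart, hp₀]
    rcases Nat.eq_zero_or_pos m with rfl | hm
    · simp [h0, k0, shift, mul_comm]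
    · have := heq m hm
      have e : shift (k m) 0 = k m := by simp [shift]
      rw [e]
      linear_combination this
  · rw [← part_zero_eq_eulerPart, part_ofParts hhn, h0, hp₀]
    exact ⟨1, -X, by ring⟩

end Fuchs
end

theorem theorem6 (p₀ : ℂ[X]) (V : ℕ → Submodule ℂ (Fuchs.Residues p₀))
    (hV : Fuchs.IsAffineNormalForm p₀ V)
    (L : Fuchs.Operator) (hL : Fuchs.IsFuchsian L) (hp₀ : Fuchs.eulerPart L = p₀) :
    ∃ q : ℕ → ℂ[X],
      (∀ j ∈ Finset.Icc 1 (Fuchs.maxResonance p₀),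
        (q j).degree < p₀.degree ∧
          Ideal.Quotient.mk (Ideal.span {p₀}) (q j) ∈ V j) ∧
      Fuchs.FuchsianEquivalent L
        (Fuchs.eulerOp p₀ + ∑ j ∈ Finset.Icc 1 (Fuchs.maxResonance p₀),
          (PowerSeries.X ^ j : PowerSeries ℂ) • Fuchs.eulerOp (q j)) :=
  Fuchs.exists_fuchsianEquivalent_normalForm p₀ V hV L hL hp₀
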